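/- Let $0<I_1<I_2<I_3$ and $l>0$. On the sphere $\mathcal S_l=\{p\in\mathbb R^3:\tfrac12(p_1^2+p_2^2+p_3^2)=l\}$ consider the symplectic form \[ \omega=\frac{dp_1\wedge dp_2}{3p_3}=\frac{dp_2\wedge dp_3}{3p_1}=\frac{dp_3\wedge dp_1}{3p_2} \] and the Hamiltonian $H=\frac12\left(\frac{p_1^2}{I_1}+\frac{p_2^2}{I_2}+\frac{p_3^2}{I_3}\right)$ of the free rigid body. Let $\mathcal H$ be a Birkhoff normal form of $H$ at the elliptic equilibrium $q=(-\sqrt{2l},0,0)$; that is, $\mathcal H$ is a real analytic function near $0\in\mathbb R$ with $\mathcal H(0)=0$, $\mathcal H'(0)\neq 0$, and there are real analytic local coordinates $(x,y)$ on $\mathcal S_l$ centred at $q$ such that $\omega=dx\wedge dy$ and \[ H-\frac{l}{I_1}=\mathcal H\left(\frac{x^2+y^2}{2}\right) \] near $q$. Let $\Phi$ be the inverse function of $\mathcal H$ near $0$. Then for every $h$ in some neighbourhood of $H(q)=l/I_1$ the function $\Phi$ is differentiable at $h-l/I_1$ and \[ \Phi'\left(h-\frac{l}{I_1}\right)=S(a,b,c,d):=-\frac{1}{3\pi}\sqrt{\frac{2}{l}}\,\frac{1}{\sqrt{(d-c)(a-b)}}\,\mathcal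 K\left(\frac{(d-a)(b-c)}{(d-c)(b-a)}\right), \] where $a=\frac1{I_1}$, $b=\frac1{I_2}$, $c=\frac1{I_3}$, $d=\frac hl$ and $\mathcal K(\lambda)=\int_0^1\frac{dx}{\sqrt{(1-x^2)(1-\lambda x^2)}}$ is the complete elliptic integral of the first kind. -/

import Mathlib

open Filter Topology
open scoped Matrix

namespace FreeRigidBody

/-- The squared-length Casimir `L(p) = (p₁² + p₂² + p₃²) / 2` of the angular momentum. -/
noncomputable def casimir (p : Fin 3 → ℝ) : ℝ :=
  (p 0 ^ 2 + p 1 ^ 2 + p 2 ^ 2) / 2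

/-- The reduced phase space `L = l`, a sphere of radius `√(2 l)` in `ℝ³`. -/
def orbit (l : ℝ) : Set (Fin 3 → ℝ) :=
  {p | casimir p = l}

/-- The Hamiltonian `H(p) = (p₁² / I₁ + p₂² / I₂ + p₃² / I₃) / 2` of the free rigid body. -/
noncomputable def hamiltonian (I₁ I₂ I₃ : ℝ) (p : Fin 3 → ℝ) : ℝ :=
  (p 0 ^ 2 / I₁ + p 1 ^ 2 / I₂ + p 2 ^ 2 / I₃) / 2

/-- The symplectic form `ω` of the orbit, at the point `p`, evaluated on tangent vectors `v`, `w`.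
This is the expression, valid on the whole sphere, of
`ω = dp₁ ∧ dp₂ / (3 p₃) = dp₂ ∧ dp₃ / (3 p₁) = dp₃ ∧ dp₁ / (3 p₂)`;
the agreement is proved in the three lemmas below. -/
noncomputable def orbitForm (p v w : Fin 3 → ℝ) : ℝ :=
  (p ⬝ᵥ (v ⨯₃ w)) / (3 * (p ⬝ᵥ p))

theorem orbitForm_eq_of_fst_ne {p v w : Fin 3 → ℝ} (hv : p ⬝ᵥ v = 0) (hw : p ⬝ᵥ w = 0)
    (hp : p 0 ≠ 0) : orbitForm p v w = (v 1 * w 2 - v 2 * w 1) / (3 * p 0) := by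
  simp only [dotProduct, Fin.sum_univ_three] at hv hw
  have h : 0 < p 0 * p 0 + p 1 * p 1 + p 2 * p 2 := by
    have := mul_self_pos.mpr hp
    nlinarith [mul_self_nonneg (p 1), mul_self_nonneg (p 2)]
  simp only [orbitForm, dotProduct, cross_apply, Fin.sum_univ_three, Matrix.cons_val]
  rw [div_eq_div_iff (by positivity) (by simpa using hp)]
  linear_combination (3 * p 1 * w 2 - 3 * p 2 * w 1) * (-hv) +
    (3 * p 1 * v 2 - 3 * p 2 * v 1) * hw

theorem orbitForm_eq_of_snd_ne {p v w : Fin 3 → ℝ} (hv : p ⬝ᵥ v = 0) (hw : p ⬝ᵥ w = 0)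
    (hp : p 1 ≠ 0) : orbitForm p v w = (v 2 * w 0 - v 0 * w 2) / (3 * p 1) := by
  simp only [dotProduct, Fin.sum_univ_three] at hv hw
  have h : 0 < p 0 * p 0 + p 1 * p 1 + p 2 * p 2 := by
    have := mul_self_pos.mpr hp
    nlinarith [mul_self_nonneg (p 0), mul_self_nonneg (p 2)]
  simp only [orbitForm, dotProduct, cross_apply, Fin.sum_univ_three, Matrix.cons_val]
  rw [div_eq_div_iff (by positivity) (by simpa using hp)]
  linear_combination (3 * p 2 * w 0 - 3 * p 0 * w 2) * (-hv) +
    (3 * p 2 * v 0 - 3 * p 0 * v 2) * hw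

theorem orbitForm_eq_of_thd_ne {p v w : Fin 3 → ℝ} (hv : p ⬝ᵥ v = 0) (hw : p ⬝ᵥ w = 0)
    (hp : p 2 ≠ 0) : orbitForm p v w = (v 0 * w 1 - v 1 * w 0) / (3 * p 2) := by
  simp only [dotProduct, Fin.sum_univ_three] at hv hw
  have h : 0 < p 0 * p 0 + p 1 * p 1 + p 2 * p 2 := by
    have := mul_self_pos.mpr hp
    nlinarith [mul_self_nonneg (p 0), mul_self_nonneg (p 1)]
  simp only [orbitForm, dotProduct, cross_apply, Fin.sum_univ_three, Matrix.cons_val]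
  rw [div_eq_div_iff (by positivity) (by simpa using hp)]
  linear_combination (3 * p 0 * w 1 - 3 * p 1 * w 0) * (-hv) +
    (3 * p 0 * v 1 - 3 * p 1 * v 0) * hw

/-- `ψ` is the inverse `(x, y) ↦ p` of a real analytic Darboux coordinate system `(x, y)` of
`(orbit l, ω)`, defined near the point `q` and centred there: near the origin it takes values in
the orbit, and `ψ^* ω = dx ∧ dy`. (As `ω(∂ψ/∂x, ∂ψ/∂y) = 1`, the map `ψ` is an immersion at the
origin, hence a local analytic diffeomorphism onto a neighbourhood of `q` in the orbit.) -/
structure IsDarbouxParametrization (l : ℝ) (q : Fin 3 → ℝ) (ψ : ℝ × ℝ → (Fin 3 → ℝ)) : Prop where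
  analyticAt : AnalyticAt ℝ ψ 0
  map_zero : ψ 0 = q
  mem_orbit : ∀ᶠ z in 𝓝 (0 : ℝ × ℝ), ψ z ∈ orbit l
  symplectic : ∀ᶠ z in 𝓝 (0 : ℝ × ℝ),
    orbitForm (ψ z) (fderiv ℝ ψ z (1, 0)) (fderiv ℝ ψ z (0, 1)) = 1

/-- `ℋ` is a Birkhoff normal form of the reduced Hamiltonian at the elliptic equilibrium `q`: it is
analytic and invertible around the origin, `ℋ 0 = 0`, and in suitable analytic Darboux coordinates
`(x, y)` centred at `q` one has `H - H(q) = ℋ ((x² + y²) / 2)`. -/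
structure IsBirkhoffNormalForm (I₁ I₂ I₃ l : ℝ) (q : Fin 3 → ℝ) (ℋ : ℝ → ℝ) : Prop where
  analyticAt : AnalyticAt ℝ ℋ 0
  map_zero : ℋ 0 = 0
  deriv_ne_zero : deriv ℋ 0 ≠ 0
  exists_coordinates : ∃ ψ : ℝ × ℝ → (Fin 3 → ℝ), IsDarbouxParametrization l q ψ ∧
    ∀ᶠ z in 𝓝 (0 : ℝ × ℝ),
      hamiltonian I₁ I₂ I₃ (ψ z) - hamiltonian I₁ I₂ I₃ q = ℋ ((z.1 ^ 2 + z.2 ^ 2) / 2)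

/-- `Φ` is the inverse function of `ℋ`, as germs at the origin. -/
def IsGermInverse (Φ ℋ : ℝ → ℝ) : Prop :=
  (∀ᶠ s in 𝓝 (0 : ℝ), Φ (ℋ s) = s) ∧ ∀ᶠ e in 𝓝 (0 : ℝ), ℋ (Φ e) = e

/-- The complete elliptic integral of the first kind, as a function of the parameter `lam`
(the square of the modulus). -/
noncomputable def ellipticK (lam : ℝ) : ℝ :=
  ∫ x in (0 : ℝ)..1, 1 / √((1 - x ^ 2) * (1 - lam * x ^ 2))

/-- The function `S(a, b, c, d)`, which also depends on the fixed level `l` of the Casimir. -/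
noncomputable def S (l a b c d : ℝ) : ℝ :=
  -(1 / (3 * Real.pi)) * √(2 / l) * (1 / √((d - c) * (a - b))) *
    ellipticK (((d - a) * (b - c)) / ((d - c) * (b - a)))

end FreeRigidBody

/-! In the rescaled chart `v = (√(a - c) p₃, √(a - b) p₂)` the energy near `q` is exactly `H - H(q)
= -|v|² / 2`. The disc `|v| < R` is therefore also a disc in the Darboux coordinates `(x, y)`, with
`(x² + y²) / 2 < Φ(-R² / 2)`. Computing its symplectic area in both charts gives `2π Φ(-R² / 2) =
∫_{|v| < R} k`, where `k` is the density of `|ω|` (`integral_disc_eq_of_area_density`).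
Differentiating in `R` expresses `Φ'(-R² / 2)` as minus the mean of `k` over a circle
(`deriv_eq_integral_of_area_density`). This mean is a complete elliptic integral
(`integral_areaDensity_eq`). As `q` is a local maximum of `H` on the sphere, this argument only
reaches energies below `H(q)`. Both sides are analytic at `H(q)` (`analyticAt_S`), so the identity
theorem extends the formula to a full neighbourhood. -/

/-! ### Areas of discs and circle means -/

open MeasureTheory Set in
theorem integral_disc_eq_integral_polar {k : ℝ × ℝ → ℝ} (hk : Continuous k) {R : ℝ} (hR : 0 < R) :
    ∫ v in {v : ℝ × ℝ | v.1 ^ 2 + v.2 ^ 2 < R ^ 2}, k v =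
      ∫ r in (0 : ℝ)..R, r * ∫ θ in (-Real.pi)..Real.pi, k (r * Real.cos θ, r * Real.sin θ) := by
  have hmeas : MeasurableSet {v : ℝ × ℝ | v.1 ^ 2 + v.2 ^ 2 < R ^ 2} :=
    (isOpen_lt (by fun_prop) (by fun_prop)).measurableSet
  have hsq (r θ : ℝ) : (r * Real.cos θ) ^ 2 + (r * Real.sin θ) ^ 2 = r ^ 2 := by
    linear_combination r ^ 2 * Real.sin_sq_add_cos_sq θ
  rw [← integral_indicator hmeas, ← integral_comp_polarCoord_symm]
  have hind : ∀ p ∈ polarCoord.target,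
      p.1 • indicator {v : ℝ × ℝ | v.1 ^ 2 + v.2 ^ 2 < R ^ 2} k (polarCoord.symm p) =
        indicator (Iio R ×ˢ univ)
          (fun p : ℝ × ℝ => p.1 * k (p.1 * Real.cos p.2, p.1 * Real.sin p.2)) p := by
    rintro ⟨r, θ⟩ hp
    have hr : 0 < r := by simpa using hp.1
    by_cases h : r < R
    · rw [indicator_of_mem, indicator_of_mem]
      · simp
      · simpa using h
      · simpa [hsq] using pow_lt_pow_left₀ h hr.le two_ne_zero
    · rw [indicator_of_notMem, indicator_of_notMem]
      · simp
      · simpa using h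
      · simpa [hsq] using pow_le_pow_left₀ hR.le (not_lt.mp h) 2
  rw [setIntegral_congr_fun polarCoord.open_target.measurableSet hind,
    setIntegral_indicator (measurableSet_Iio.prod MeasurableSet.univ)]
  have hset : polarCoord.target ∩ Iio R ×ˢ univ = Ioo 0 R ×ˢ Ioo (-Real.pi) Real.pi := by
    ext ⟨r, θ⟩
    simp [polarCoord_target]
    tauto
  have hcont : Continuous
      (fun p : ℝ × ℝ => p.1 * k (p.1 * Real.cos p.2, p.1 * Real.sin p.2)) := by fun_prop
  rw [hset, Measure.volume_eq_prod, setIntegral_prod]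
  · rw [intervalIntegral.integral_of_le hR.le, integral_Ioc_eq_integral_Ioo]
    refine setIntegral_congr_fun measurableSet_Ioo fun r _ => ?_
    simp only
    rw [integral_const_mul, intervalIntegral.integral_of_le (by linarith [Real.pi_pos]),
      integral_Ioc_eq_integral_Ioo]
  · exact (hcont.continuousOn.integrableOn_compact (isCompact_Icc.prod isCompact_Icc)).mono_set
      (prod_mono Ioo_subset_Icc_self Ioo_subset_Icc_self)

open MeasureTheory in
theorem integral_disc_one {R : ℝ} (hR : 0 < R) :
    ∫ _ in {v : ℝ × ℝ | v.1 ^ 2 + v.2 ^ 2 < R ^ 2}, (1 : ℝ) = Real.pi * R ^ 2 := by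
  rw [integral_disc_eq_integral_polar continuous_const hR]
  simp
  ring

/-- If an analytic function `f` with `f' 0 ≠ 0` is nonnegative to the right of its zero `0`, it is
strictly increasing near `0`. -/
theorem exists_strictMonoOn_of_nonneg {f : ℝ → ℝ} (hf : AnalyticAt ℝ f 0) (h0 : f 0 = 0)
    (hd : deriv f 0 ≠ 0) (hpos : ∀ᶠ x in 𝓝[>] 0, 0 ≤ f x) :
    ∃ δ > 0, StrictMonoOn f (Set.Ioo (-δ) δ) := by
  have hd0 : 0 ≤ deriv f 0 := by
    have ht := (hasDerivAt_iff_tendsto_slope.mp hf.differentiableAt.hasDerivAt).mono_left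
      (nhdsWithin_mono 0 (fun x (hx : 0 < x) => hx.ne') : 𝓝[>] (0 : ℝ) ≤ 𝓝[≠] 0)
    refine ge_of_tendsto ht ?_
    filter_upwards [hpos, self_mem_nhdsWithin] with x hx hx0
    simp only [slope, h0, sub_zero, vsub_eq_sub, smul_eq_mul]
    exact mul_nonneg (inv_nonneg.mpr (le_of_lt hx0)) hx
  have hev : ∀ᶠ x in 𝓝 0, 0 < deriv f x ∧ AnalyticAt ℝ f x :=
    (hf.deriv.continuousAt.eventually_const_lt (lt_of_le_of_ne hd0 hd.symm)).and
      hf.eventually_analyticAt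
  obtain ⟨δ, hδ, h⟩ := Metric.eventually_nhds_iff.mp hev
  have h' : ∀ x ∈ Set.Ioo (-δ) δ, 0 < deriv f x ∧ AnalyticAt ℝ f x := fun x hx =>
    h (by rw [Real.dist_eq, sub_zero, abs_lt]; exact hx)
  refine ⟨δ, hδ, strictMonoOn_of_deriv_pos (convex_Ioo _ _)
    (fun x hx => (h' x hx).2.continuousAt.continuousWithinAt) fun x hx => (h' x ?_).1⟩
  rwa [interior_Ioo] at hx

open MeasureTheory Set in
/-- Change of variables for a local diffeomorphism `G` of the plane that carries circles centred at
the origin to circles centred at the origin. -/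
theorem integral_disc_eq_of_area_density {G : ℝ × ℝ → ℝ × ℝ} {k : ℝ × ℝ → ℝ} {Ψ : ℝ → ℝ}
    (hG : AnalyticAt ℝ G 0) (hG0 : G 0 = 0)
    (hdet : ∀ᶠ z in 𝓝 0, |(fderiv ℝ G z).det| * k (G z) = 1)
    (hΨ : AnalyticAt ℝ Ψ 0) (hΨ0 : Ψ 0 = 0) (hΨd : deriv Ψ 0 ≠ 0)
    (hN : ∀ᶠ z in 𝓝 (0 : ℝ × ℝ),
      (z.1 ^ 2 + z.2 ^ 2) / 2 = Ψ (((G z).1 ^ 2 + (G z).2 ^ 2) / 2)) :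
    ∀ᶠ R in 𝓝[>] (0 : ℝ),
      ∫ v in {v : ℝ × ℝ | v.1 ^ 2 + v.2 ^ 2 < R ^ 2}, k v = 2 * Real.pi * Ψ (R ^ 2 / 2) := by
  -- The density equation at the origin makes the Jacobian invertible, so the inverse function
  -- theorem applies.
  have hdet0 : (fderiv ℝ G 0).det ≠ 0 := fun h => by simpa [h] using hdet.self_of_nhds
  have hstrict : HasStrictFDerivAt G
      ((fderiv ℝ G 0).toContinuousLinearEquivOfDetNeZero hdet0 : ℝ × ℝ →L[ℝ] ℝ × ℝ) 0 := by
    rw [ContinuousLinearMap.coe_toContinuousLinearEquivOfDetNeZero]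
    exact hG.hasStrictFDerivAt
  set e := hstrict.toOpenPartialHomeomorph with he
  have hcoe : (e : ℝ × ℝ → ℝ × ℝ) = G := rfl
  have hsrc : (0 : ℝ × ℝ) ∈ e.source := hstrict.mem_toOpenPartialHomeomorph_source
  have htgt : (0 : ℝ × ℝ) ∈ e.target := by
    have := e.map_source hsrc
    rwa [hcoe, hG0] at this
  have hsymm0 : e.symm 0 = 0 := by
    have := e.left_inv hsrc
    rwa [hcoe, hG0] at this
  have hsymm : Tendsto e.symm (𝓝 0) (𝓝 0) := by
    have := e.continuousAt_symm htgt
    rwa [ContinuousAt, hsymm0] at this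
  -- the relation between the radii, at the points of the target
  have hN' : ∀ᶠ v in 𝓝 (0 : ℝ × ℝ),
      ((e.symm v).1 ^ 2 + (e.symm v).2 ^ 2) / 2 = Ψ ((v.1 ^ 2 + v.2 ^ 2) / 2) := by
    filter_upwards [hsymm.eventually hN, e.open_target.mem_nhds htgt] with v hv hvt
    rw [hv, ← hcoe, e.right_inv hvt]
  -- The point `(√(2x), 0)` has a preimage under `G`, and `Ψ x` is half the squared norm of that
  -- preimage.
  have hpos : ∀ᶠ x in 𝓝[>] (0 : ℝ), 0 ≤ Ψ x := by
    have ht : Tendsto (fun x : ℝ => ((√(2 * x), 0) : ℝ × ℝ)) (𝓝 0) (𝓝 0) := by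
      have : Continuous (fun x : ℝ => ((√(2 * x), 0) : ℝ × ℝ)) := by fun_prop
      simpa using! this.tendsto 0
    filter_upwards [(ht.eventually hN').filter_mono nhdsWithin_le_nhds, self_mem_nhdsWithin]
      with x hx hx0
    have hx0' : 0 ≤ 2 * x := by have : 0 < x := hx0; linarith
    simp only [Real.sq_sqrt hx0'] at hx
    have hx' : Ψ x = ((e.symm (√(2 * x), 0)).1 ^ 2 + (e.symm (√(2 * x), 0)).2 ^ 2) / 2 := by
      rw [hx]; congr 1; ring
    rw [hx']
    positivity
  obtain ⟨δ, hδ, hmono⟩ := exists_strictMonoOn_of_nonneg hΨ hΨ0 hΨd hpos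
  have hGc : Tendsto G (𝓝 0) (𝓝 0) := by simpa [ContinuousAt, hG0] using! hG.continuousAt
  have hNtend : Tendsto (fun v : ℝ × ℝ => (v.1 ^ 2 + v.2 ^ 2) / 2) (𝓝 0) (𝓝 0) := by
    have : Continuous (fun v : ℝ × ℝ => (v.1 ^ 2 + v.2 ^ 2) / 2) := by fun_prop
    simpa using! this.tendsto 0
  -- a neighbourhood of the origin where everything holds
  have hgood : ∀ᶠ z in 𝓝 (0 : ℝ × ℝ), z ∈ e.source ∧ |(fderiv ℝ G z).det| * k (G z) = 1 ∧
      DifferentiableAt ℝ G z ∧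
      (z.1 ^ 2 + z.2 ^ 2) / 2 = Ψ (((G z).1 ^ 2 + (G z).2 ^ 2) / 2) ∧
      ((G z).1 ^ 2 + (G z).2 ^ 2) / 2 < δ := by
    filter_upwards [e.open_source.mem_nhds hsrc, hdet, hG.eventually_analyticAt, hN,
      (hNtend.comp hGc).eventually_lt_const hδ] with z h1 h2 h3 h4 h5
    exact ⟨h1, h2, h3.differentiableAt, h4, h5⟩
  -- discs are small
  have hdisc : ∀ P : ℝ × ℝ → Prop, (∀ᶠ z in 𝓝 0, P z) → ∃ η > 0, ∀ z : ℝ × ℝ,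
      z.1 ^ 2 + z.2 ^ 2 < η → P z := by
    intro P hP
    obtain ⟨ρ, hρ, h⟩ := Metric.eventually_nhds_iff.mp hP
    refine ⟨ρ ^ 2, by positivity, fun z hz => h ?_⟩
    rw [dist_zero_right, Prod.norm_def, max_lt_iff, Real.norm_eq_abs, Real.norm_eq_abs]
    exact ⟨abs_lt_of_sq_lt_sq (by nlinarith [sq_nonneg z.2]) hρ.le,
      abs_lt_of_sq_lt_sq (by nlinarith [sq_nonneg z.1]) hρ.le⟩
  obtain ⟨η, hη, hgood⟩ := hdisc _ hgood
  obtain ⟨η', hη', hgood'⟩ := hdisc _ ((hsymm.eventually (eventually_of_mem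
    ((isOpen_lt (by fun_prop : Continuous fun z : ℝ × ℝ => z.1 ^ 2 + z.2 ^ 2)
      continuous_const).mem_nhds (by simpa using hη : (0 : ℝ × ℝ) ∈
      {z : ℝ × ℝ | z.1 ^ 2 + z.2 ^ 2 < η})) fun _ h => h)).and (e.open_target.mem_nhds htgt))
  have hsqR : Tendsto (fun R : ℝ => R ^ 2) (𝓝[>] 0) (𝓝 0) := by
    have : Continuous (fun R : ℝ => R ^ 2) := by fun_prop
    simpa using (this.tendsto 0).mono_left nhdsWithin_le_nhds
  have hΨR : Tendsto (fun R : ℝ => 2 * Ψ (R ^ 2 / 2)) (𝓝[>] 0) (𝓝 0) := by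
    have h1 : Tendsto (fun R : ℝ => R ^ 2 / 2) (𝓝[>] 0) (𝓝 0) := by
      simpa using hsqR.div_const 2
    have h2 := hΨ.continuousAt.tendsto
    rw [hΨ0] at h2
    simpa using (h2.comp h1).const_mul 2
  filter_upwards [hsqR.eventually_lt_const hη', hsqR.eventually_lt_const hδ,
    hΨR.eventually_lt_const hη, self_mem_nhdsWithin] with R hR1 hR2 hR3 hR0
  have hR0 : 0 < R := hR0
  have hRsq : 0 < R ^ 2 := by positivity
  have hmemR : R ^ 2 / 2 ∈ Ioo (-δ) δ := ⟨by linarith, by linarith⟩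
  have hΨpos : 0 < Ψ (R ^ 2 / 2) := by
    rw [← hΨ0]; exact hmono ⟨by linarith, by linarith⟩ hmemR (by linarith)
  -- The radius of the source disc that `G` maps onto the disc of radius `R`.
  set T : ℝ := √(2 * Ψ (R ^ 2 / 2)) with hT
  have hTsq : T ^ 2 = 2 * Ψ (R ^ 2 / 2) := Real.sq_sqrt (by linarith)
  have hTpos : 0 < T := Real.sqrt_pos.mpr (by linarith)
  have hlt : ∀ z : ℝ × ℝ, z.1 ^ 2 + z.2 ^ 2 < η →
      ((G z).1 ^ 2 + (G z).2 ^ 2 < R ^ 2 ↔ z.1 ^ 2 + z.2 ^ 2 < T ^ 2) := by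
    intro z hz
    obtain ⟨-, -, -, h4, h5⟩ := hgood z hz
    have := hmono.lt_iff_lt (a := ((G z).1 ^ 2 + (G z).2 ^ 2) / 2)
      ⟨by nlinarith [sq_nonneg (G z).1, sq_nonneg (G z).2], h5⟩ hmemR
    rw [← h4] at this
    rw [hTsq]
    constructor
    · intro h
      linarith [this.mpr (by linarith)]
    · intro h
      linarith [this.mp (by linarith)]
  have himage : G '' {z : ℝ × ℝ | z.1 ^ 2 + z.2 ^ 2 < T ^ 2} =
      {v : ℝ × ℝ | v.1 ^ 2 + v.2 ^ 2 < R ^ 2} := by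
    ext v
    constructor
    · rintro ⟨z, hz, rfl⟩
      exact (hlt z (lt_trans hz (hTsq ▸ hR3))).mpr hz
    · intro hv
      obtain ⟨h1, h2⟩ := hgood' v (lt_trans hv hR1)
      have hGv : G (e.symm v) = v := e.right_inv h2
      exact ⟨e.symm v, (hlt _ h1).mp (by rw [hGv]; exact hv), hGv⟩
  have hsub : ∀ z ∈ {z : ℝ × ℝ | z.1 ^ 2 + z.2 ^ 2 < T ^ 2}, z.1 ^ 2 + z.2 ^ 2 < η :=
    fun z hz => lt_trans hz (hTsq ▸ hR3)
  have hmeas : MeasurableSet {z : ℝ × ℝ | z.1 ^ 2 + z.2 ^ 2 < T ^ 2} :=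
    (isOpen_lt (by fun_prop) (by fun_prop)).measurableSet
  rw [← himage, integral_image_eq_integral_abs_det_fderiv_smul volume hmeas
    (fun z hz => (hgood z (hsub z hz)).2.2.1.hasFDerivAt.hasFDerivWithinAt)
    (e.injOn.mono fun z hz => (hgood z (hsub z hz)).1),
    setIntegral_congr_fun hmeas (g := fun _ => (1 : ℝ)) fun z hz => by
      simpa only [smul_eq_mul] using (hgood z (hsub z hz)).2.1,
    integral_disc_one hTpos, hTsq]
  ring

/-- The derivative of the area function is the mean of the density over circles. -/
theorem deriv_eq_integral_of_area_density {G : ℝ × ℝ → ℝ × ℝ} {k : ℝ × ℝ → ℝ} {Ψ : ℝ → ℝ}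
    (hk : Continuous k) (hG : AnalyticAt ℝ G 0) (hG0 : G 0 = 0)
    (hdet : ∀ᶠ z in 𝓝 0, |(fderiv ℝ G z).det| * k (G z) = 1)
    (hΨ : AnalyticAt ℝ Ψ 0) (hΨ0 : Ψ 0 = 0) (hΨd : deriv Ψ 0 ≠ 0)
    (hN : ∀ᶠ z in 𝓝 (0 : ℝ × ℝ),
      (z.1 ^ 2 + z.2 ^ 2) / 2 = Ψ (((G z).1 ^ 2 + (G z).2 ^ 2) / 2)) :
    ∀ᶠ R in 𝓝[>] (0 : ℝ), 2 * Real.pi * deriv Ψ (R ^ 2 / 2) =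
      ∫ θ in (-Real.pi)..Real.pi, k (R * Real.cos θ, R * Real.sin θ) := by
  have harea := integral_disc_eq_of_area_density hG hG0 hdet hΨ hΨ0 hΨd hN
  have hR : Tendsto (fun R : ℝ => R ^ 2 / 2) (𝓝[>] 0) (𝓝 0) := by
    have : Continuous (fun R : ℝ => R ^ 2 / 2) := by fun_prop
    simpa using (this.tendsto 0).mono_left nhdsWithin_le_nhds
  filter_upwards [eventually_eventually_nhdsWithin.mpr harea, hR.eventually hΨ.eventually_analyticAt,
    self_mem_nhdsWithin] with R hR1 hR2 hR0
  have hR0 : 0 < R := hR0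
  -- The area identity now holds on a neighbourhood of `R`, so it can be differentiated there.
  rw [isOpen_Ioi.nhdsWithin_eq hR0] at hR1
  set J : ℝ → ℝ := fun r => ∫ θ in (-Real.pi)..Real.pi, k (r * Real.cos θ, r * Real.sin θ) with hJ
  have hJc : Continuous J :=
    intervalIntegral.continuous_parametric_intervalIntegral_of_continuous' (by fun_prop) _ _
  have hrJ : Continuous fun r => r * J r := continuous_id.mul hJc
  have h1 : HasDerivAt (fun x => ∫ r in (0 : ℝ)..x, r * J r) (R * J R) R :=
    intervalIntegral.integral_hasDerivAt_right (hrJ.intervalIntegrable _ _)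
      (hrJ.stronglyMeasurableAtFilter _ _) hrJ.continuousAt
  have h2 : HasDerivAt (fun x : ℝ => 2 * Real.pi * Ψ (x ^ 2 / 2))
      (2 * Real.pi * (deriv Ψ (R ^ 2 / 2) * R)) R := by
    have h3 : HasDerivAt (fun x : ℝ => x ^ 2 / 2) R R := by
      refine ((hasDerivAt_pow 2 R).div_const 2).congr_deriv ?_
      norm_num
    exact (hR2.differentiableAt.hasDerivAt.comp R h3).const_mul _
  have h3 : (fun x : ℝ => 2 * Real.pi * Ψ (x ^ 2 / 2)) =ᶠ[𝓝 R]
      fun x => ∫ r in (0 : ℝ)..x, r * J r := by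
    filter_upwards [hR1, lt_mem_nhds hR0] with x hx hx0
    rw [← hx, integral_disc_eq_integral_polar hk hx0]
  have h4 := h2.unique (h1.congr_of_eventuallyEq h3)
  exact mul_right_cancel₀ hR0.ne' (by linarith)

/-! ### The complete elliptic integral -/

namespace FreeRigidBody

/-- The trigonometric form of the complete elliptic integral. -/
theorem ellipticK_eq_integral_sin (lam : ℝ) :
    ellipticK lam = ∫ θ in (0 : ℝ)..(Real.pi / 2), 1 / √(1 - lam * Real.sin θ ^ 2) := by
  have himage : Real.sin '' Set.Ioo 0 (Real.pi / 2) = Set.Ioo 0 1 := by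
    have hmono : StrictMonoOn Real.sin (Set.Icc 0 (Real.pi / 2)) :=
      Real.strictMonoOn_sin.mono (Set.Icc_subset_Icc (by linarith [Real.pi_pos]) le_rfl)
    ext x
    constructor
    · rintro ⟨θ, ⟨h0, h1⟩, rfl⟩
      refine ⟨Real.sin_pos_of_pos_of_lt_pi h0 (by linarith), ?_⟩
      rw [← Real.sin_pi_div_two]
      exact hmono ⟨h0.le, h1.le⟩ ⟨by linarith, le_rfl⟩ h1
    · rintro ⟨h0, h1⟩
      refine ⟨Real.arcsin x, ⟨Real.arcsin_pos.mpr h0, Real.arcsin_lt_pi_div_two.mpr h1⟩,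
        Real.sin_arcsin (by linarith) h1.le⟩
  have hinj : Set.InjOn Real.sin (Set.Ioo 0 (Real.pi / 2)) :=
    Real.strictMonoOn_sin.injOn.mono (Set.Ioo_subset_Icc_self.trans
      (Set.Icc_subset_Icc (by linarith [Real.pi_pos]) le_rfl))
  rw [ellipticK, intervalIntegral.integral_of_le zero_le_one,
    MeasureTheory.integral_Ioc_eq_integral_Ioo, ← himage,
    MeasureTheory.integral_image_eq_integral_abs_deriv_smul measurableSet_Ioo
      (fun x _ => (Real.hasDerivAt_sin x).hasDerivWithinAt) hinj,
    intervalIntegral.integral_of_le (by positivity), MeasureTheory.integral_Ioc_eq_integral_Ioo]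
  refine MeasureTheory.setIntegral_congr_fun measurableSet_Ioo fun θ hθ => ?_
  have hcos : 0 < Real.cos θ :=
    Real.cos_pos_of_mem_Ioo ⟨by linarith [hθ.1, Real.pi_pos], hθ.2⟩
  simp only [smul_eq_mul]
  rw [← Real.cos_sq', Real.sqrt_mul (sq_nonneg _), Real.sqrt_sq hcos.le, abs_of_pos hcos]
  -- `lam` is arbitrary, so the root may vanish; both sides are then `0` by the convention for
  -- division.
  by_cases h : √(1 - lam * Real.sin θ ^ 2) = 0
  · simp [h]
  · field_simp

theorem integral_sin_sq_eq_four_mul {f : ℝ → ℝ} (hf : Continuous fun θ => f (Real.sin θ ^ 2)) :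
    ∫ θ in (-Real.pi)..Real.pi, f (Real.sin θ ^ 2) =
      4 * ∫ θ in (0 : ℝ)..(Real.pi / 2), f (Real.sin θ ^ 2) := by
  have hi (a b : ℝ) : IntervalIntegrable (fun θ => f (Real.sin θ ^ 2)) MeasureTheory.volume a b :=
    hf.intervalIntegrable a b
  have h1 : ∫ θ in (-Real.pi)..0, f (Real.sin θ ^ 2) = ∫ θ in (0 : ℝ)..Real.pi, f (Real.sin θ ^ 2) := by
    have := intervalIntegral.integral_comp_neg (a := 0) (b := Real.pi)
      (fun θ => f (Real.sin θ ^ 2))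
    simpa using this.symm
  have h2 : ∫ θ in (Real.pi / 2)..Real.pi, f (Real.sin θ ^ 2) =
      ∫ θ in (0 : ℝ)..(Real.pi / 2), f (Real.sin θ ^ 2) := by
    have := intervalIntegral.integral_comp_sub_left (a := 0) (b := Real.pi / 2)
      (fun θ => f (Real.sin θ ^ 2)) Real.pi
    simp only [Real.sin_pi_sub, sub_zero] at this
    rw [this]
    congr 1
    ring
  rw [← intervalIntegral.integral_add_adjacent_intervals (hi (-Real.pi) 0) (hi 0 Real.pi), h1,
    ← intervalIntegral.integral_add_adjacent_intervals (hi 0 (Real.pi / 2)) (hi _ Real.pi), h2]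
  ring

theorem one_sub_mul_sin_sq_pos {lam : ℝ} (h : lam < 1) (θ : ℝ) : 0 < 1 - lam * Real.sin θ ^ 2 := by
  rcases (sq_nonneg (Real.sin θ)).eq_or_lt with h0 | h0
  · simp [← h0]
  · nlinarith [Real.sin_sq_le_one θ]

theorem four_mul_ellipticK {lam : ℝ} (h : lam < 1) :
    ∫ θ in (-Real.pi)..Real.pi, 1 / √(1 - lam * Real.sin θ ^ 2) = 4 * ellipticK lam := by
  rw [ellipticK_eq_integral_sin]
  refine integral_sin_sq_eq_four_mul (f := fun x => 1 / √(1 - lam * x)) ?_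
  exact continuous_const.div (by fun_prop) fun θ =>
    (Real.sqrt_pos.mpr (one_sub_mul_sin_sq_pos h θ)).ne'

/-- Complex differentiation under the integral sign makes the integral holomorphic on the disc `|z|
< 1/2`, where the base of the power has real part at least `1/2` and avoids the branch cut; the
function is the real trace of this extension. -/
theorem analyticAt_ellipticK : AnalyticAt ℝ ellipticK 0 := by
  set F : ℂ → ℂ := fun z =>
    ∫ θ in (0 : ℝ)..(Real.pi / 2), (1 - z * (Real.sin θ : ℂ) ^ 2) ^ (-(1 / 2) : ℂ) with hF
  have hre : ∀ z ∈ Metric.ball (0 : ℂ) (1 / 2), ∀ θ : ℝ,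
      1 / 2 ≤ (1 - z * (Real.sin θ : ℂ) ^ 2).re := by
    intro z hz θ
    have hz' : |z.re| < 1 / 2 := (Complex.abs_re_le_norm z).trans_lt (by simpa using hz)
    have : (1 - z * (Real.sin θ : ℂ) ^ 2).re = 1 - z.re * Real.sin θ ^ 2 := by
      rw [← Complex.ofReal_pow, Complex.sub_re, Complex.re_mul_ofReal, Complex.one_re]
    rw [this]
    nlinarith [abs_lt.mp hz', sq_nonneg (Real.sin θ), Real.sin_sq_le_one θ]
  have hslit : ∀ z ∈ Metric.ball (0 : ℂ) (1 / 2), ∀ θ : ℝ,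
      1 - z * (Real.sin θ : ℂ) ^ 2 ∈ Complex.slitPlane := fun z hz θ =>
    Or.inl (by linarith [hre z hz θ])
  have hcont : ∀ s : ℂ, ∀ z ∈ Metric.ball (0 : ℂ) (1 / 2),
      Continuous fun θ : ℝ => (1 - z * (Real.sin θ : ℂ) ^ 2) ^ s := fun s z hz =>
    Continuous.cpow (by fun_prop) continuous_const fun θ => hslit z hz θ
  have hdiff : DifferentiableOn ℂ F (Metric.ball 0 (1 / 2)) := by
    intro z hz
    refine (intervalIntegral.hasDerivAt_integral_of_dominated_loc_of_deriv_le
      (F' := fun w (θ : ℝ) => (-(1 / 2) : ℂ) * (1 - w * (Real.sin θ : ℂ) ^ 2) ^ (-(1 / 2) - 1 : ℂ) *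
        (-(Real.sin θ : ℂ) ^ 2))
      (bound := fun _ => 4) (Metric.isOpen_ball.mem_nhds hz) ?_
      ((hcont _ z hz).intervalIntegrable _ _) ?_ ?_ intervalIntegrable_const
      ?_).2.differentiableAt.differentiableWithinAt
    · filter_upwards [Metric.isOpen_ball.mem_nhds hz] with w hw
      exact (hcont _ w hw).aestronglyMeasurable
    · have := hcont (-(1 / 2) - 1 : ℂ) z hz
      exact Continuous.aestronglyMeasurable (by fun_prop)
    · refine Eventually.of_forall fun θ _ w hw => ?_
      have h1 := hre w hw θ
      have h2 : (1 / 2 : ℝ) ≤ ‖1 - w * (Real.sin θ : ℂ) ^ 2‖ :=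
        h1.trans ((le_abs_self _).trans (Complex.abs_re_le_norm _))
      have h3 : ‖(1 - w * (Real.sin θ : ℂ) ^ 2) ^ (-(1 / 2) - 1 : ℂ)‖ ≤ 4 := by
        have : (-(1 / 2) - 1 : ℂ) = ((-(3 / 2) : ℝ) : ℂ) := by push_cast; ring
        rw [this, Complex.norm_cpow_real]
        calc ‖1 - w * (Real.sin θ : ℂ) ^ 2‖ ^ (-(3 / 2) : ℝ) ≤ (1 / 2 : ℝ) ^ (-(3 / 2) : ℝ) :=
              Real.rpow_le_rpow_of_nonpos (by norm_num) h2 (by norm_num)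
          _ ≤ (1 / 2 : ℝ) ^ (-2 : ℝ) :=
              Real.rpow_le_rpow_of_exponent_ge (by norm_num) (by norm_num) (by norm_num)
          _ = 4 := by
              rw [Real.rpow_neg (by norm_num), Real.rpow_two]; norm_num
      have h4 : ‖(Real.sin θ : ℂ) ^ 2‖ ≤ 1 := by
        rw [← Complex.ofReal_pow, Complex.norm_real, Real.norm_of_nonneg (sq_nonneg _)]
        exact Real.sin_sq_le_one θ
      rw [norm_mul, norm_mul, norm_neg, norm_neg]
      have h5 : ‖(1 / 2 : ℂ)‖ = 1 / 2 := by norm_num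
      rw [h5]
      nlinarith [norm_nonneg ((1 - w * (Real.sin θ : ℂ) ^ 2) ^ (-(1 / 2) - 1 : ℂ)),
        norm_nonneg ((Real.sin θ : ℂ) ^ 2)]
    · refine Eventually.of_forall fun θ _ w hw => ?_
      have h1 : HasDerivAt (fun w : ℂ => 1 - w * (Real.sin θ : ℂ) ^ 2)
          (-(Real.sin θ : ℂ) ^ 2) w := by
        simpa using ((hasDerivAt_id w).mul_const ((Real.sin θ : ℂ) ^ 2)).const_sub 1
      exact h1.cpow_const (hslit w hw θ)
  have hFan : AnalyticAt ℂ F ((0 : ℝ) : ℂ) := by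
    rw [Complex.ofReal_zero]
    exact hdiff.analyticAt (Metric.ball_mem_nhds _ (by norm_num))
  refine hFan.re_ofReal.congr ?_
  filter_upwards [Metric.ball_mem_nhds (0 : ℝ) (by norm_num : (0 : ℝ) < 1 / 2)] with x hx
  have hx' : |x| < 1 / 2 := by simpa using hx
  rw [ellipticK_eq_integral_sin]
  have h : ∀ θ : ℝ, (1 - (x : ℂ) * (Real.sin θ : ℂ) ^ 2) ^ (-(1 / 2) : ℂ) =
      ((1 / √(1 - x * Real.sin θ ^ 2) : ℝ) : ℂ) := by
    intro θ
    have hp := one_sub_mul_sin_sq_pos (by linarith [abs_lt.mp hx'] : x < 1) θ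
    have hs : 1 / √(1 - x * Real.sin θ ^ 2) = (1 - x * Real.sin θ ^ 2) ^ (-(1 / 2) : ℝ) := by
      rw [Real.rpow_neg hp.le, ← Real.sqrt_eq_rpow, inv_eq_one_div]
    rw [hs, Complex.ofReal_cpow hp.le]
    push_cast
    rfl
  simp only [hF, h]
  rw [intervalIntegral.integral_ofReal, Complex.ofReal_re]

end FreeRigidBody

/-! ### Planar determinants and inverse germs -/

theorem det_eq_of_real_prod (L : ℝ × ℝ →L[ℝ] ℝ × ℝ) :
    L.det = (L (1, 0)).1 * (L (0, 1)).2 - (L (0, 1)).1 * (L (1, 0)).2 := by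
  rw [ContinuousLinearMap.det, ← LinearMap.det_toMatrix (Module.Basis.finTwoProd ℝ),
    Matrix.det_fin_two]
  simp [LinearMap.toMatrix_apply]

/-- A germ of left inverse of an analytic function with nonzero derivative is analytic. -/
theorem AnalyticAt.of_eventually_leftInverse {f g : ℝ → ℝ} (hf : AnalyticAt ℝ f 0) (h0 : f 0 = 0)
    (hd : deriv f 0 ≠ 0) (hg : ∀ᶠ s in 𝓝 0, g (f s) = s) :
    AnalyticAt ℝ g 0 ∧ deriv g 0 ≠ 0 := by
  have hg_an : AnalyticAt ℝ g 0 := by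
    have hinv := hf.analyticAt_localInverse hd
    rw [h0] at hinv
    refine hinv.congr ?_
    have := hf.hasStrictDerivAt.eventually_right_inverse hd
    have hto := (hf.hasStrictDerivAt.to_localInverse hd).hasDerivAt.continuousAt.tendsto
    rw [h0] at this hto
    have hl : HasStrictDerivAt.localInverse f (deriv f 0) 0 hf.hasStrictDerivAt hd 0 = 0 := by
      have := (hf.hasStrictDerivAt.eventually_left_inverse hd).self_of_nhds
      rwa [h0] at this
    rw [hl] at hto
    filter_upwards [this, hto.eventually hg] with x hx1 hx2
    rw [← hx2, hx1]
  refine ⟨hg_an, fun h => ?_⟩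
  have hg' : HasDerivAt g (deriv g 0) (f 0) := by
    rw [h0]; exact hg_an.differentiableAt.hasDerivAt
  have h1 := hg'.comp (0 : ℝ) hf.differentiableAt.hasDerivAt
  have h2 := h1.unique ((hasDerivAt_id (0 : ℝ)).congr_of_eventuallyEq hg)
  simp [h] at h2

/-! ### The symplectic area density near the equilibrium -/

namespace FreeRigidBody

theorem orbit_dotProduct_fderiv_eq_zero {l : ℝ} {ψ : ℝ × ℝ → Fin 3 → ℝ} {z : ℝ × ℝ}
    (hψ : DifferentiableAt ℝ ψ z) (h : ∀ᶠ w in 𝓝 z, ψ w ∈ orbit l) (v : ℝ × ℝ) :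
    ψ z ⬝ᵥ fderiv ℝ ψ z v = 0 := by
  have hi (i : Fin 3) := hasFDerivAt_pi'.mp hψ.hasFDerivAt i
  have h1 := ((((hi 0).pow 2).add ((hi 1).pow 2)).add ((hi 2).pow 2))
  have h2 : HasFDerivAt (fun w => ψ w 0 ^ 2 + ψ w 1 ^ 2 + ψ w 2 ^ 2) (0 : ℝ × ℝ →L[ℝ] ℝ) z := by
    refine (hasFDerivAt_const (2 * l) z).congr_of_eventuallyEq ?_
    filter_upwards [h] with w hw
    have : (ψ w 0 ^ 2 + ψ w 1 ^ 2 + ψ w 2 ^ 2) / 2 = l := hw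
    linarith
  have h3 := congrArg (fun L : ℝ × ℝ →L[ℝ] ℝ => L v) (HasFDerivAt.unique h1 h2)
  simp at h3
  simp only [dotProduct, Fin.sum_univ_three]
  linarith

/-- The density of `|ω|` with respect to `dv₁ dv₂` in the coordinates
`v = (√(a - c) p₃, √(a - b) p₂)` around `(-√(2 l), 0, 0)`; it is truncated so as to be continuous
on the whole plane. -/
noncomputable def areaDensity (l a b c : ℝ) (v : ℝ × ℝ) : ℝ :=
  1 / (3 * (√(a - c) * √(a - b)) * √(max (2 * l - v.1 ^ 2 / (a - c) - v.2 ^ 2 / (a - b)) l))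

theorem continuous_areaDensity {l a b c : ℝ} (hl : 0 < l) (hab : b < a) (hac : c < a) :
    Continuous (areaDensity l a b c) := by
  refine continuous_const.div (by fun_prop) fun v => ?_
  have h1 : 0 < √(a - c) := Real.sqrt_pos.mpr (by linarith)
  have h2 : 0 < √(a - b) := Real.sqrt_pos.mpr (by linarith)
  have h3 : 0 < √(max (2 * l - v.1 ^ 2 / (a - c) - v.2 ^ 2 / (a - b)) l) :=
    Real.sqrt_pos.mpr (lt_max_of_lt_right hl)
  positivity

theorem integral_areaDensity_eq {l a b c : ℝ} (hl : 0 < l) (hab : b < a) (hbc : c < b) {R : ℝ}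
    (hR : 0 < R) (hRl : R ^ 2 ≤ l * (a - b)) :
    ∫ θ in (-Real.pi)..Real.pi, areaDensity l a b c (R * Real.cos θ, R * Real.sin θ) =
      -(2 * Real.pi * S l a b c (a - R ^ 2 / 2 / l)) := by
  have hab' : 0 < a - b := by linarith
  have hac' : 0 < a - c := by linarith
  have hbc' : 0 < b - c := by linarith
  set d := a - R ^ 2 / 2 / l with hd
  have hRd : R ^ 2 = 2 * l * (a - d) := by rw [hd]; field_simp; ring
  have hda : 0 < a - d := by
    have : 0 < 2 * l * (a - d) := hRd ▸ by positivity
    exact pos_of_mul_pos_right this (by positivity)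
  have had : a - d ≤ (a - b) / 2 := by
    rw [hRd] at hRl
    nlinarith
  have hdc : 0 < d - c := by linarith
  set lam := (d - a) * (b - c) / ((d - c) * (b - a)) with hlam
  have hba : b - a ≠ 0 := by linarith
  have hlam' : lam * ((d - c) * (a - b)) = (a - d) * (b - c) := by
    rw [hlam]; field_simp; ring
  -- `(d - c)(a - b) - (a - d)(b - c) = (a - c)(d - b)`, and `d > b` because `a - d ≤ (a - b) / 2`.
  have hlam1 : lam < 1 := by
    have : 0 < (d - c) * (a - b) := by positivity
    nlinarith
  clear_value lam d
  have hrad : ∀ θ : ℝ, 2 * l - (R * Real.cos θ) ^ 2 / (a - c) - (R * Real.sin θ) ^ 2 / (a - b) =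
      2 * l * (d - c) / (a - c) * (1 - lam * Real.sin θ ^ 2) := by
    intro θ
    rw [mul_pow, mul_pow, hRd, Real.cos_sq']
    field_simp
    linear_combination Real.sin θ ^ 2 * hlam'
  -- The bound `R² ≤ l (a - b)` keeps the truncation inactive on the circle.
  have hmax : ∀ θ : ℝ, max (2 * l - (R * Real.cos θ) ^ 2 / (a - c) -
      (R * Real.sin θ) ^ 2 / (a - b)) l = 2 * l * (d - c) / (a - c) * (1 - lam * Real.sin θ ^ 2) := by
    intro θ
    rw [← hrad, max_eq_left]
    have h1 : (R * Real.cos θ) ^ 2 / (a - c) ≤ (R * Real.cos θ) ^ 2 / (a - b) := by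
      gcongr
    have h2 : (R * Real.cos θ) ^ 2 / (a - b) + (R * Real.sin θ) ^ 2 / (a - b) = R ^ 2 / (a - b) := by
      rw [← add_div]; congr 1; linear_combination R ^ 2 * Real.sin_sq_add_cos_sq θ
    have h3 : R ^ 2 / (a - b) ≤ l := by rwa [div_le_iff₀ hab']
    linarith
  have hint : ∀ θ : ℝ, areaDensity l a b c (R * Real.cos θ, R * Real.sin θ) =
      1 / (3 * √(a - b) * √2 * √l * √(d - c)) * (1 / √(1 - lam * Real.sin θ ^ 2)) := by
    intro θ
    have hs := Real.sqrt_pos.mpr hac'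
    rw [areaDensity, hmax, Real.sqrt_mul (by positivity), Real.sqrt_div (by positivity),
      Real.sqrt_mul (by positivity), Real.sqrt_mul (by positivity)]
    have := Real.sqrt_pos.mpr (one_sub_mul_sin_sq_pos hlam1 θ)
    have := Real.sqrt_pos.mpr hdc
    have := Real.sqrt_pos.mpr hab'
    have := Real.sqrt_pos.mpr hl
    field_simp
  simp only [hint]
  rw [intervalIntegral.integral_const_mul, four_mul_ellipticK hlam1, S, ← hlam,
    Real.sqrt_mul hdc.le, Real.sqrt_div (by positivity)]
  have := Real.sqrt_pos.mpr hdc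
  have := Real.sqrt_pos.mpr hab'
  have := Real.sqrt_pos.mpr hl
  have h2 : √(2 : ℝ) ^ 2 = 2 := Real.sq_sqrt (by norm_num)
  have := Real.pi_pos
  field_simp
  rw [h2]
  ring

theorem analyticAt_S {l a b c : ℝ} (hab : b < a) (hbc : c < b) :
    AnalyticAt ℝ (S l a b c) a := by
  have hpos : 0 < (a - c) * (a - b) := mul_pos (by linarith) (by linarith)
  have hsqrt : AnalyticAt ℝ Real.sqrt ((a - c) * (a - b)) :=
    (Real.contDiffAt_sqrt (n := ⊤) hpos.ne').analyticAt
  have h1 : AnalyticAt ℝ (fun d : ℝ => √((d - c) * (a - b))) a :=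
    hsqrt.comp (f := fun d : ℝ => (d - c) * (a - b)) (by fun_prop)
  have h2 : AnalyticAt ℝ (fun d : ℝ => (d - a) * (b - c) / ((d - c) * (b - a))) a :=
    AnalyticAt.div (by fun_prop) (by fun_prop)
      (mul_ne_zero (by linarith) (by linarith))
  have hK : AnalyticAt ℝ ellipticK
      ((fun d : ℝ => (d - a) * (b - c) / ((d - c) * (b - a))) a) := by
    simpa using analyticAt_ellipticK
  have h3 := hK.comp (f := fun d : ℝ => (d - a) * (b - c) / ((d - c) * (b - a))) h2
  exact (analyticAt_const.mul (analyticAt_const.div h1 (Real.sqrt_pos.mpr hpos).ne')).mul h3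

theorem IsDarbouxParametrization.eventually_abs_det {l a b c : ℝ} (hl : 0 < l) (hab : b < a)
    (hac : c < a) {ψ : ℝ × ℝ → Fin 3 → ℝ}
    (hψ : IsDarbouxParametrization l ![-√(2 * l), 0, 0] ψ) :
    ∀ᶠ z in 𝓝 0, |(fderiv ℝ (fun z => (√(a - c) * ψ z 2, √(a - b) * ψ z 1)) z).det| *
      areaDensity l a b c (√(a - c) * ψ z 2, √(a - b) * ψ z 1) = 1 := by
  have hα := Real.sqrt_pos.mpr (sub_pos.mpr hac)
  have hβ := Real.sqrt_pos.mpr (sub_pos.mpr hab)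
  have hcont (i : Fin 3) : ContinuousAt (fun z => ψ z i) 0 :=
    (continuous_apply i).continuousAt.comp hψ.analyticAt.continuousAt
  have hneg : ∀ᶠ z in 𝓝 0, ψ z 0 < -√l := by
    -- Since `-√(2l) < -√l`, near `q` one has `p₁ < 0` and `p₁² > l`: the first makes the formula
    -- for `ω` over `3 p₁` available, the second switches off the truncation.
    refine (hcont 0).eventually_lt_const ?_
    simpa [hψ.map_zero] using Real.sqrt_lt_sqrt hl.le (by linarith : l < 2 * l)
  filter_upwards [hneg, eventually_eventually_nhds.mpr hψ.mem_orbit, hψ.symplectic,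
    hψ.analyticAt.eventually_analyticAt] with z hz horb hsymp han
  have hl0 : 0 ≤ √l := Real.sqrt_nonneg l
  have hz0 : ψ z 0 < 0 := by linarith
  have hsq : l < ψ z 0 ^ 2 := by
    rw [← Real.sq_sqrt hl.le]; nlinarith
  have hcas : (ψ z 0 ^ 2 + ψ z 1 ^ 2 + ψ z 2 ^ 2) / 2 = l := horb.self_of_nhds
  rw [orbitForm_eq_of_fst_ne (orbit_dotProduct_fderiv_eq_zero han.differentiableAt horb _)
    (orbit_dotProduct_fderiv_eq_zero han.differentiableAt horb _) hz0.ne,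
    div_eq_one_iff_eq (by linarith)] at hsymp
  have hi (i : Fin 3) := hasFDerivAt_pi'.mp han.differentiableAt.hasFDerivAt i
  have hG := ((hi 2).const_mul √(a - c)).prodMk ((hi 1).const_mul √(a - b))
  -- Listing `p₃` before `p₂` reverses the sign, which compensates `p₁ < 0`: the determinant is
  -- positive.
  have hdet : (fderiv ℝ (fun z => (√(a - c) * ψ z 2, √(a - b) * ψ z 1)) z).det =
      3 * (√(a - c) * √(a - b)) * (-ψ z 0) := by
    rw [hG.fderiv, det_eq_of_real_prod]
    simp
    linear_combination (-√(a - c) * √(a - b)) * hsymp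
  have hrad : 2 * l - (√(a - c) * ψ z 2) ^ 2 / (a - c) - (√(a - b) * ψ z 1) ^ 2 / (a - b) =
      (-ψ z 0) ^ 2 := by
    rw [mul_pow, mul_pow, Real.sq_sqrt (by linarith), Real.sq_sqrt (by linarith),
      mul_div_cancel_left₀ _ (by linarith), mul_div_cancel_left₀ _ (by linarith)]
    linarith
  have hp : 0 < -ψ z 0 := by linarith
  rw [hdet, abs_of_pos (by positivity), areaDensity, hrad, max_eq_left (by linarith [neg_sq (ψ z 0)]),
    Real.sqrt_sq hp.le]
  exact mul_one_div_cancel (by positivity)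

theorem hamiltonian_sub_eq {I₁ I₂ I₃ l : ℝ} (hl : 0 ≤ l) {p : Fin 3 → ℝ} (hp : p ∈ orbit l) :
    hamiltonian I₁ I₂ I₃ p - hamiltonian I₁ I₂ I₃ ![-√(2 * l), 0, 0] =
      -(((1 / I₁ - 1 / I₃) * p 2 ^ 2 + (1 / I₁ - 1 / I₂) * p 1 ^ 2) / 2) := by
  have h : (p 0 ^ 2 + p 1 ^ 2 + p 2 ^ 2) / 2 = l := hp
  have h0 : p 0 ^ 2 = 2 * l - p 1 ^ 2 - p 2 ^ 2 := by linarith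
  have hq : (-√(2 * l)) ^ 2 = 2 * l := by rw [neg_sq, Real.sq_sqrt (by positivity)]
  simp only [hamiltonian, h0, Matrix.cons_val, hq]
  ring

end FreeRigidBody

/-! ### From circle means to the derivative of the inverse normal form -/

open FreeRigidBody in
theorem corollary4p2 (I₁ I₂ I₃ l : ℝ) (hI₁ : 0 < I₁) (hI₁₂ : I₁ < I₂) (hI₂₃ : I₂ < I₃)
    (hl : 0 < l) (ℋ Φ : ℝ → ℝ)
    (hℋ : FreeRigidBody.IsBirkhoffNormalForm I₁ I₂ I₃ l ![-√(2 * l), 0, 0] ℋ)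
    (hΦ : FreeRigidBody.IsGermInverse Φ ℋ) :
    ∀ᶠ h in 𝓝 (l / I₁),
      HasDerivAt Φ (FreeRigidBody.S l (1 / I₁) (1 / I₂) (1 / I₃) (h / l)) (h - l / I₁) := by
  set a := 1 / I₁ with ha
  set b := 1 / I₂ with hb
  set c := 1 / I₃ with hc
  have hab : b < a := one_div_lt_one_div_of_lt hI₁ hI₁₂
  have hbc : c < b := one_div_lt_one_div_of_lt (hI₁.trans hI₁₂) hI₂₃
  have hac : c < a := hbc.trans hab
  obtain ⟨ψ, hψ, hψℋ⟩ := hℋ.exists_coordinates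
  obtain ⟨hΦan, hΦd⟩ := AnalyticAt.of_eventually_leftInverse hℋ.analyticAt hℋ.map_zero
    hℋ.deriv_ne_zero hΦ.1
  have hΦ0 : Φ 0 = 0 := by
    have := hΦ.1.self_of_nhds
    rwa [hℋ.map_zero] at this
  set G : ℝ × ℝ → ℝ × ℝ := fun z => (√(a - c) * ψ z 2, √(a - b) * ψ z 1) with hGdef
  have hψi (i : Fin 3) : AnalyticAt ℝ (fun z => ψ z i) 0 :=
    (ContinuousLinearMap.proj (R := ℝ) (φ := fun _ : Fin 3 => ℝ) i).analyticAt _ |>.comp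
      hψ.analyticAt
  have hG : AnalyticAt ℝ G 0 :=
    (analyticAt_const.mul (hψi 2)).prod (analyticAt_const.mul (hψi 1))
  have hG0 : G 0 = 0 := by simp [hGdef, hψ.map_zero]
  have hΨan : AnalyticAt ℝ (fun x => Φ (-x)) 0 := by
    have : AnalyticAt ℝ Φ (-0) := by simpa using hΦan
    exact this.comp (f := fun x : ℝ => -x) analyticAt_id.neg
  have hN : ∀ᶠ z in 𝓝 (0 : ℝ × ℝ),
      (z.1 ^ 2 + z.2 ^ 2) / 2 = Φ (-(((G z).1 ^ 2 + (G z).2 ^ 2) / 2)) := by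
    have htend : Tendsto (fun z : ℝ × ℝ => (z.1 ^ 2 + z.2 ^ 2) / 2) (𝓝 0) (𝓝 0) := by
      have : Continuous (fun z : ℝ × ℝ => (z.1 ^ 2 + z.2 ^ 2) / 2) := by fun_prop
      simpa using! this.tendsto 0
    filter_upwards [hψℋ, hψ.mem_orbit, htend.eventually hΦ.1] with z hz horb hinv
    rw [hamiltonian_sub_eq hl.le horb] at hz
    rw [← hinv, ← hz]
    simp only [hGdef, mul_pow, Real.sq_sqrt (sub_pos.mpr hab).le, Real.sq_sqrt (sub_pos.mpr hac).le]
    rfl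
  have hmain := deriv_eq_integral_of_area_density (continuous_areaDensity hl hab hac) hG hG0
    (hψ.eventually_abs_det hl hab hac) hΨan (by simpa using hΦ0)
    (by rw [deriv_comp_neg]; simpa using hΦd) hN
  have hsq : Tendsto (fun R : ℝ => R ^ 2) (𝓝[>] 0) (𝓝 0) := by
    have : Continuous (fun R : ℝ => R ^ 2) := by fun_prop
    simpa using (this.tendsto 0).mono_left nhdsWithin_le_nhds
  have hright : ∀ᶠ R in 𝓝[>] (0 : ℝ), deriv Φ (-(R ^ 2 / 2)) = S l a b c (a + -(R ^ 2 / 2) / l) := by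
    filter_upwards [hmain, self_mem_nhdsWithin,
      hsq.eventually_lt_const (mul_pos hl (sub_pos.mpr hab))] with R hR hR0 hRl
    rw [integral_areaDensity_eq hl hab hbc hR0 hRl.le, deriv_comp_neg] at hR
    have hpi := Real.pi_pos
    rw [neg_div, ← sub_eq_add_neg]
    have : 2 * Real.pi * (deriv Φ (-(R ^ 2 / 2)) - S l a b c (a - R ^ 2 / 2 / l)) = 0 := by linarith
    rcases mul_eq_zero.mp this with h | h <;> linarith
  have hSan : AnalyticAt ℝ (fun e => S l a b c (a + e / l)) 0 := by
    have : AnalyticAt ℝ (S l a b c) ((fun e : ℝ => a + e / l) 0) := by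
      simpa using analyticAt_S hab hbc
    exact this.comp (f := fun e : ℝ => a + e / l) (by fun_prop)
  have hto : Tendsto (fun R : ℝ => -(R ^ 2 / 2)) (𝓝[>] 0) (𝓝[≠] 0) := by
    refine tendsto_nhdsWithin_iff.mpr ⟨by simpa using (hsq.div_const 2).neg, ?_⟩
    filter_upwards [self_mem_nhdsWithin] with R hR
    have : 0 < R := hR
    have : 0 < R ^ 2 := by positivity
    exact (by linarith : -(R ^ 2 / 2) < 0).ne
  -- The values `-R² / 2` accumulate at `0`, so agreement there propagates by analyticity to `e ≥ 0`
  -- as well.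
  have heq : ∀ᶠ e in 𝓝 (0 : ℝ), deriv Φ e = S l a b c (a + e / l) :=
    (hΦan.deriv.frequently_eq_iff_eventually_eq hSan).mp (hto.frequently hright.frequently)
  have hshift : Tendsto (fun h : ℝ => h - l / I₁) (𝓝 (l / I₁)) (𝓝 0) := by
    have : Continuous (fun h : ℝ => h - l / I₁) := by fun_prop
    simpa using this.tendsto (l / I₁)
  filter_upwards [hshift.eventually heq, hshift.eventually hΦan.eventually_analyticAt] with h h1 h2
  have : h / l = a + (h - l / I₁) / l := by
    rw [ha]; field_simp; ring
  rw [this, ← h1]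
  exact h2.differentiableAt.hasDerivAt
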